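/- Let $k$ be an algebraically closed field and let $\mathcal O$ be the ring of a reduced algebroid curve over $k$, not necessarily Gorenstein: a complete noetherian local reduced $k$-algebra with coefficient field $k$ (i.e. $k$ maps isomorphically onto the residue field of $\mathcal O$), such that $\mathcal O/\wp$ has dimension one for each of its minimal primes $\wp_1,\dots,\wp_r$. Let $\mathcal K$ be the total ring of fractions of $\mathcal O$ and, for $1\le i\le r$, let $\pi_i:\mathcal K\to\mathcal K_i=\operatorname{Frac}(\mathcal O/\wp_i)$ be the projection and $v_i$ the normalized discrete valuation of $\mathcal K_i$ whose valuation ring is the integral closure of $\mathcal O/\wp_i$ in $\mathcal K_i$, with $v_i(0)=\infty$. Put $v(h)=(v_1(\pi_1(h)),\dots,v_r(\pi_r(h)))$. The semigroup of values $S=\{v(h): h\in\mathcal O \text{ regular}\}\subset\mathbb Z^r$ has a conductor $c(S)$, that is, a least element $\gamma\in S$ (for the componentwise order) such that $\gamma+\mathbb N^r\subset S$. A fractional ideal of $\mathcal O$ is an $\mathcal O$-submodule $\mathcal I\subset\mathcal K$ that contains a regular element of $\mathcal O$ and satisfies $d\,\mathcal I\subset\mathcal O$ for some regular $d\in\mathcal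 O$; its dual is $\mathcal I^*=\{x\in\mathcal K: x\,\mathcal I\subset\mathcal O\}$. For $\alpha\in\mathbb Z^r$ put $\mathcal I(\alpha)=\{h\in\mathcal I: v_i(\pi_i(h))\ge\alpha_i \text{ for all } i\}$, and similarly $\mathcal I^*(\alpha)$. Let $e_i$ be the $i$-th standard basis vector of $\mathbb Z^r$ and let $\ell$ denote the length of an $\mathcal O$-module. Then for every fractional ideal $\mathcal I$ of $\mathcal O$, every $\alpha\in\mathbb Z^r$ and every $i\in\{1,\dots,r\}$, $$\ell\left(\frac{\mathcal I(\alpha)}{\mathcal I(\alpha+e_i)}\right)+\ell\left(\frac{\mathcal I^*(c(S)-\alpha-e_i)}{\mathcal I^*(c(S)-\alpha)}\right)\le 1.$$ -/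

import Mathlib

/-- The ring `O` of a reduced algebroid curve over the algebraically closed field `k`: a complete
noetherian local reduced `k`-algebra, with `k` as a coefficient field (the residue field is `k`),
all of whose irreducible components have dimension one. -/
structure IsAlgebroidCurve (k O : Type*) [Field k] [CommRing O] [Algebra k O] : Prop
    extends IsLocalRing O, IsNoetherianRing O, IsReduced O where
  isAlgClosed : IsAlgClosed k
  isAdicComplete : IsAdicComplete (IsLocalRing.maximalIdeal O) O
  bijective_residue : Function.Bijective (algebraMap k (IsLocalRing.ResidueField O))
  ringKrullDim_quotient : ∀ p ∈ minimalPrimes O, ringKrullDim (O ⧸ p) = 1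

namespace AlgebroidCurve

open scoped nonZeroDivisors WithZero

variable {O : Type*} [CommRing O]

/-- The branches of the curve are the minimal primes of its ring. -/
instance isPrime_branch (p : minimalPrimes O) : p.1.IsPrime := p.2.1.1

/-- The function field of the branch `p`, the field of fractions of `O ⧸ p`. -/
abbrev BranchField (p : minimalPrimes O) : Type _ := FractionRing (O ⧸ p.1)

/-- The normalization of the branch `p`, the integral closure of `O ⧸ p` in its fraction field. -/
abbrev BranchNormalization (p : minimalPrimes O) : Subalgebra (O ⧸ p.1) (BranchField p) :=
  integralClosure (O ⧸ p.1) (BranchField p)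

instance isFractionRing_branchNormalization (p : minimalPrimes O) :
    IsFractionRing (BranchNormalization p) (BranchField p) :=
  integralClosure.isFractionRing_of_finite_extension (BranchField p) (BranchField p)

theorem isUnit_toBranchField (p : minimalPrimes O) (a : O⁰) :
    IsUnit (((algebraMap (O ⧸ p.1) (BranchField p)).comp (Ideal.Quotient.mk p.1)) a) := by
  rw [isUnit_iff_ne_zero, RingHom.comp_apply, Ne,
    FaithfulSMul.algebraMap_eq_zero_iff (O ⧸ p.1) (BranchField p), Ideal.Quotient.eq_zero_iff_mem]
  exact fun h => Set.disjoint_left.1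
    (Ideal.disjoint_nonZeroDivisors_of_mem_minimalPrimes p.2) h a.2

/-- The projection from the total ring of fractions of `O` to the function field of the
branch `p`, extending `O → O ⧸ p`. -/
noncomputable def proj (p : minimalPrimes O) : FractionRing O →+* BranchField p :=
  IsLocalization.lift (M := O⁰) (isUnit_toBranchField p)

open Classical in
/-- The normalized discrete valuation of the function field of the branch `p`, whose valuation ring
is the normalization of the branch, written multiplicatively: an element of order `n` is sent to
`WithZero.exp (-n)`, and `0` to `0`. The normalization of a branch of an algebroid curve always is
a discrete valuation ring, so that the second alternative never occurs for such a curve. -/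
noncomputable def val (p : minimalPrimes O) : Valuation (BranchField p) ℤᵐ⁰ :=
  if _h : IsDiscreteValuationRing (BranchNormalization p) then
    (IsDiscreteValuationRing.maximalIdeal (BranchNormalization p)).valuation (BranchField p)
  else 1

theorem val_algebraMap_le_one (p : minimalPrimes O) (a : O ⧸ p.1) :
    val p (algebraMap (O ⧸ p.1) (BranchField p) a) ≤ 1 := by
  unfold val
  split_ifs with h
  · exact (IsDiscreteValuationRing.maximalIdeal (BranchNormalization p)).valuation_le_one
      (algebraMap (O ⧸ p.1) (BranchNormalization p) a)
  · classical exact Valuation.one_apply_le_one _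

/-- `HasValue h α` says that `v(h) = α`: on each branch `p`, the element `h` has order `α p`. -/
def HasValue (h : FractionRing O) (α : minimalPrimes O → ℤ) : Prop :=
  ∀ p, val p (proj p h) = WithZero.exp (-(α p))

/-- The value set `v(M ∖ Z(K)) ⊆ ℤ^r` of a submodule `M` of the total ring of fractions `K`, where
`Z(K)` is the set of zero divisors. -/
def valueSet (M : Submodule O (FractionRing O)) : Set (minimalPrimes O → ℤ) :=
  {α | ∃ h ∈ M, h ∈ (FractionRing O)⁰ ∧ HasValue h α}

variable (O) in
/-- The semigroup of values of `O`. -/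
def semigroup : Set (minimalPrimes O → ℤ) := valueSet (1 : Submodule O (FractionRing O))

/-- `c` is the conductor of the set `E`: the least element `γ` of `E` with `γ + ℕ^r ⊆ E`. -/
def IsConductor {ι : Type*} (E : Set (ι → ℤ)) (c : ι → ℤ) : Prop :=
  IsLeast {γ | γ ∈ E ∧ ∀ β, γ ≤ β → β ∈ E} c

/-- A fractional ideal of `O`: an `O`-submodule of the total ring of fractions that contains a
regular element of `O` and has a regular common denominator in `O`. -/
structure IsFractionalIdeal (M : Submodule O (FractionRing O)) : Prop where
  exists_regular : ∃ a ∈ O⁰, algebraMap O (FractionRing O) a ∈ M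
  exists_denominator : ∃ d ∈ O⁰, ∀ x ∈ M, d • x ∈ (1 : Submodule O (FractionRing O))

/-- The dual `M^* = (O : M) = {x | x M ⊆ O}`. -/
noncomputable def dual (M : Submodule O (FractionRing O)) : Submodule O (FractionRing O) := 1 / M

/-- `M(α)`, the submodule of all `h ∈ M` whose order on each branch `p` is at least `α p`; an `h`
that vanishes on the branch has order `∞` there. -/
def filtration (M : Submodule O (FractionRing O)) (α : minimalPrimes O → ℤ) :
    Submodule O (FractionRing O) where
  carrier := {h | h ∈ M ∧ ∀ p, val p (proj p h) ≤ WithZero.exp (-(α p))}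
  zero_mem' := ⟨M.zero_mem, fun p => by simp⟩
  add_mem' := fun hx hy => ⟨M.add_mem hx.1 hy.1, fun p => by
    rw [map_add]
    exact (val p).map_add_le (hx.2 p) (hy.2 p)⟩
  smul_mem' := fun a x hx => ⟨M.smul_mem a hx.1, fun p => by
    have h : proj p (algebraMap O (FractionRing O) a)
        = algebraMap (O ⧸ p.1) (BranchField p) (Ideal.Quotient.mk p.1 a) := by
      simp [proj]
    rw [Algebra.smul_def, map_mul, map_mul, h]
    exact (mul_le_of_le_one_left' (val_algebraMap_le_one p _)).trans (hx.2 p)⟩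

/-- The length of the `O`-module `M / N`, for submodules `N ⊆ M`. -/
noncomputable def colength (M N : Submodule O (FractionRing O)) : ℕ∞ :=
  Module.length O (M ⧸ N.submoduleOf M)

open Classical in
/-- The standard basis vector `e_i` of `ℤ^r`. -/
noncomputable def basisVec (i : minimalPrimes O) : minimalPrimes O → ℤ := Pi.single i 1

end AlgebroidCurve

/-! Passing from `α` to `α + e_i` only discards the elements whose order on branch `i` is exactly `α
i`. Since the residue field of the normalized branch is again `k`, two such elements differ on that
branch, to leading order, by a scalar. Hence each of the two lengths is at most 1
(`colength_filtration_le_one`).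

If both were 1, choose `x` in `M(α)` and `y` in `M^*(c - α - e_i)` representing nonzero classes.
Then `y * x` lies in `O`, has order exactly `c i - 1` on branch `i`, and order at least `c p` on
every other branch. No such element exists (`false_of_val_eq_conductor_sub_one`): everything of
order at least `c` lies in `O` (`filtration_one_le`), so cancelling leading terms against it would
make every `β ≥ c - e_i` a value, contradicting the minimality of `c`.

The foundations are that each normalized branch is a discrete valuation ring with a common
denominator, which rests on Chevalley's theorem, and that the conductor exists, because elements of
large order lie in `O` and the semigroup is closed under minima. -/

/-! ### Decreasing sequences of ideals in a complete local ring. -/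

open IsLocalRing in
/-- **Chevalley's theorem**: in a complete noetherian local ring a decreasing sequence of ideals with
zero intersection is cofinal with the powers of the maximal ideal. -/
theorem exists_le_maximalIdeal_pow_of_iInf_eq_bot {A : Type*} [CommRing A] [IsLocalRing A]
    [IsNoetherianRing A] [IsAdicComplete (maximalIdeal A) A] {I : ℕ → Ideal A} (hI : Antitone I)
    (hbot : ⨅ n, I n = ⊥) (j : ℕ) : ∃ n, I n ≤ maximalIdeal A ^ j := by
  by_contra! hcon
  have stab : ∀ j, ∃ n, ∀ n', n ≤ n' → I n ⊔ maximalIdeal A ^ j = I n' ⊔ maximalIdeal A ^ j := by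
    intro j
    have : IsArtinianRing (A ⧸ maximalIdeal A ^ j) := by
      rcases Nat.eq_zero_or_pos j with rfl | hj
      · rw [pow_zero, Ideal.one_eq_top]; infer_instance
      · exact quotient_artinian_of_mem_minimalPrimes_of_isLocalRing _
          ⟨⟨inferInstance, Ideal.pow_le_self hj.ne'⟩, fun q hq _ => hq.1.le_of_pow_le hq.2⟩
    obtain ⟨n, hn⟩ := IsArtinian.monotone_stabilizes
      (R := A ⧸ maximalIdeal A ^ j) (M := A ⧸ maximalIdeal A ^ j)
      ⟨fun n => OrderDual.toDual ((I n).map (Ideal.Quotient.mk (maximalIdeal A ^ j))),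
        fun a b hab => Ideal.map_mono (hI hab)⟩
    refine ⟨n, fun n' hn' => ?_⟩
    have h : Ideal.comap _ (Ideal.map (Ideal.Quotient.mk (maximalIdeal A ^ j)) (I n)) =
        Ideal.comap _ (Ideal.map (Ideal.Quotient.mk (maximalIdeal A ^ j)) (I n')) :=
      congrArg (Ideal.comap (Ideal.Quotient.mk (maximalIdeal A ^ j))) (hn n' hn')
    simpa [Ideal.comap_map_of_surjective _ Ideal.Quotient.mk_surjective, ← RingHom.ker_eq_comap_bot]
      using h
  choose N hN using stab
  -- `J j` is the stable value of `I n + m^j`. Each element of `J j` agrees modulo `m^j` with one of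
  -- `J (j + 1)`, so an element outside `m^j` starts a Cauchy sequence. By Krull's theorem in `A ⧸ I
  -- n`, its limit lies in every `I n`, hence is 0.
  let J : ℕ → Ideal A := fun j => I (N j) ⊔ maximalIdeal A ^ j
  have hJle : ∀ j n, J j ≤ I n ⊔ maximalIdeal A ^ j := fun j n => by
    change I (N j) ⊔ _ ≤ _
    rw [hN j (max n (N j)) (le_max_right _ _)]
    exact sup_le_sup_right (hI (le_max_left _ _)) _
  have step : ∀ j, ∀ x : J j, ∃ y : J (j + 1), x.1 - y.1 ∈ maximalIdeal A ^ j := by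
    rintro j ⟨x, hx⟩
    obtain ⟨y, hy, z, hz, rfl⟩ := Submodule.mem_sup.1 (hJle j (N (j + 1)) hx)
    exact ⟨⟨y, Ideal.mem_sup_left hy⟩, by simpa using hz⟩
  choose F hF using step
  obtain ⟨x₀, hx₀, hx₀'⟩ := SetLike.not_le_iff_exists.1 (hcon (N j))
  let x : ∀ i, J (j + i) := fun i =>
    Nat.rec (motive := fun i => J (j + i)) ⟨x₀, Ideal.mem_sup_left hx₀⟩ (fun i y => F (j + i) y) i
  have hx : ∀ i, (x i).1 - (x (i + 1)).1 ∈ maximalIdeal A ^ (j + i) := fun i => hF (j + i) (x i)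
  have hcauchy : ∀ {m n}, m ≤ n →
      (x m).1 ≡ (x n).1 [SMOD (maximalIdeal A ^ m • ⊤ : Submodule A A)] := by
    intro m n hmn
    rw [smul_eq_mul, Ideal.mul_top, SModEq.sub_mem]
    induction n, hmn using Nat.le_induction with
    | base => simp
    | succ n hmn ih =>
      rw [← sub_add_sub_cancel _ (x n).1]
      exact add_mem ih (Ideal.pow_le_pow_right (by omega) (hx n))
  obtain ⟨L, hL⟩ := IsPrecomplete.prec (I := maximalIdeal A) inferInstance hcauchy
  simp only [smul_eq_mul, Ideal.mul_top, SModEq.sub_mem] at hL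
  have hxj : ∀ i, (x 0).1 - (x i).1 ∈ maximalIdeal A ^ j := by
    intro i
    induction i with
    | zero => simp
    | succ i ih =>
      rw [← sub_add_sub_cancel _ (x i).1]
      exact add_mem ih (Ideal.pow_le_pow_right (by omega) (hx i))
  have hL0 : L = 0 := by
    rw [← Submodule.mem_bot A, ← hbot, Submodule.mem_iInf]
    intro n
    have key : ∀ i, L ∈ I n ⊔ maximalIdeal A ^ i := by
      intro i
      have hle : I n ⊔ maximalIdeal A ^ (j + i) ≤ I n ⊔ maximalIdeal A ^ i :=
        sup_le_sup le_rfl (Ideal.pow_le_pow_right (Nat.le_add_left i j))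
      have h1 : (x i).1 ∈ I n ⊔ maximalIdeal A ^ i := hle (hJle _ n (x i).2)
      rw [← sub_sub_cancel (x i).1 L]
      exact sub_mem h1 (Ideal.mem_sup_right (hL i))
    rw [← Ideal.Quotient.eq_zero_iff_mem]
    refine IsHausdorff.haus (I := maximalIdeal A) (M := A ⧸ I n) inferInstance _ fun i => ?_
    obtain ⟨y, hy, z, hz, h⟩ := Submodule.mem_sup.1 (key i)
    rw [SModEq.zero, ← h, map_add, Ideal.Quotient.eq_zero_iff_mem.2 hy, zero_add]
    have : Ideal.Quotient.mk (I n) z = z • (1 : A ⧸ I n) := by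
      rw [Algebra.smul_def, mul_one]; rfl
    rw [this]
    exact Submodule.smul_mem_smul hz trivial
  refine hx₀' ?_
  have h2 := add_mem (hxj j) (hL j)
  simpa [hL0, x] using h2

/-! ### Finiteness of the normalization in dimension one. -/

section IntegralClosure

variable {A K : Type*} [CommRing A] [IsDomain A] [Field K] [Algebra A K] [IsFractionRing A K]

open IsLocalRing

/-- The integral closure of a complete noetherian local domain of dimension one in its field of
fractions has a common denominator. -/
theorem exists_ne_zero_forall_isIntegral_smul_mem_range [IsLocalRing A] [IsNoetherianRing A]
    [IsAdicComplete (maximalIdeal A) A] (hdim : ringKrullDim A = 1) :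
    ∃ d : A, d ≠ 0 ∧ ∀ b : K, IsIntegral A b → d • b ∈ (algebraMap A K).range := by
  obtain ⟨hfield, hrad⟩ := ringKrullDim_eq_one_iff_of_isLocalRing_isDomain.1 hdim
  obtain ⟨t, ht, ht0⟩ := Submodule.exists_mem_ne_zero_of_ne_bot
    (isField_iff_maximalIdeal_eq.not.1 hfield)
  have htK : algebraMap A K t ≠ 0 := by simpa using ht0
  have hdvd : ∀ x : A, x ≠ 0 → ∃ s, x ∣ t ^ s := fun x hx => by
    obtain ⟨s, hs⟩ := hrad x hx ht
    exact ⟨s, Ideal.mem_span_singleton.1 hs⟩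
  have hfrac : ∀ b : K, ∃ s, t ^ s • b ∈ (algebraMap A K).range := fun b => by
    obtain ⟨x, y, hy, rfl⟩ := IsFractionRing.div_surjective (A := A) b
    have hy0 := nonZeroDivisors.ne_zero hy
    obtain ⟨s, z, hz⟩ := hdvd y hy0
    have : algebraMap A K y ≠ 0 := by simpa using hy0
    exact ⟨s, z * x, by rw [hz, Algebra.smul_def, map_mul, map_mul]; field_simp⟩
  -- `I n` is the contraction to `A` of `t ^ n` times the integral closure.
  let I : ℕ → Ideal A := fun n =>
    { carrier := {a | ∃ b : K, IsIntegral A b ∧ algebraMap A K a = t ^ n • b}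
      zero_mem' := ⟨0, isIntegral_zero, by simp⟩
      add_mem' := by
        rintro a a' ⟨b, hb, h⟩ ⟨b', hb', h'⟩
        exact ⟨b + b', hb.add hb', by rw [map_add, h, h', smul_add]⟩
      smul_mem' := by
        rintro c a ⟨b, hb, h⟩
        exact ⟨c • b, hb.smul c, by rw [smul_eq_mul, map_mul, h, ← Algebra.smul_def, smul_comm]⟩ }
  have hI : Antitone I := by
    rintro m n hmn a ⟨b, hb, h⟩
    refine ⟨t ^ (n - m) • b, hb.smul _, ?_⟩
    rw [h, smul_smul, ← pow_add, Nat.add_sub_cancel' hmn]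
  have hbot : ⨅ n, I n = ⊥ := by
    rw [eq_bot_iff]
    intro x hx
    rw [Submodule.mem_iInf] at hx
    by_contra hx0
    obtain ⟨s, y, hy⟩ := hdvd x hx0
    obtain ⟨b, hb, h⟩ := hx (s + 1)
    -- From `x = t ^ (s + 1) b` and `x y = t ^ s` follows `t⁻¹ = y b`; but integral extensions
    -- create no new inverses.
    have hinv : IsIntegral A (algebraMap A K t)⁻¹ := by
      have : (algebraMap A K t)⁻¹ = y • b := by
        have h1 : algebraMap A K t ^ s = algebraMap A K x * algebraMap A K y := by
          rw [← map_pow, hy, map_mul]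
        rw [h, Algebra.smul_def, map_pow, pow_succ, mul_assoc, mul_assoc] at h1
        have h2 := mul_left_cancel₀ (pow_ne_zero s htK) ((mul_one _).trans h1)
        rw [Algebra.smul_def]
        exact inv_eq_of_mul_eq_one_right (by rw [h2]; ring)
      rw [this]
      exact hb.smul y
    have hu : IsUnit (algebraMap A (integralClosure A K) t) :=
      .of_mul_eq_one ⟨_, hinv⟩ (Subtype.ext (mul_inv_cancel₀ htK))
    exact ht (isUnit_of_map_unit _ _ hu)
  obtain ⟨j, hj⟩ : ∃ j, maximalIdeal A ^ j ≤ Ideal.span {t} :=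
    Ideal.exists_pow_le_of_le_radical_of_fg (hrad t ht0) (IsNoetherian.noetherian _)
  obtain ⟨n, hn⟩ := exists_le_maximalIdeal_pow_of_iInf_eq_bot hI hbot j
  refine ⟨t ^ n, pow_ne_zero _ ht0, fun b hb => ?_⟩
  obtain ⟨s, hs⟩ := hfrac b
  -- As `I n` lies in `(t)`, one factor `t` at a time can be divided out, down to an exponent `n`
  -- independent of `b`.
  have hred : ∀ i, t ^ (n + i) • b ∈ (algebraMap A K).range →
      t ^ n • b ∈ (algebraMap A K).range := by
    intro i
    induction i with
    | zero => exact id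
    | succ i ih =>
      rintro ⟨a, ha⟩
      refine ih ?_
      have : a ∈ I n := ⟨t ^ (i + 1) • b, hb.smul _, by rw [ha, smul_smul, ← pow_add]⟩
      obtain ⟨a', rfl⟩ := Ideal.mem_span_singleton.1 (hj (hn this))
      refine ⟨a', mul_left_cancel₀ htK ?_⟩
      rw [← map_mul, ha, ← Algebra.smul_def, smul_smul, ← pow_succ', add_assoc]
  refine hred s ?_
  obtain ⟨a, ha⟩ := hs
  exact ⟨t ^ n * a, by rw [map_mul, ha, ← Algebra.smul_def, smul_smul, pow_add]⟩

/-- The integral closure of a complete noetherian local domain of dimension one in its field of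
fractions is finite. -/
theorem finite_integralClosure_of_isAdicComplete [IsLocalRing A] [IsNoetherianRing A]
    [IsAdicComplete (maximalIdeal A) A] (hdim : ringKrullDim A = 1) :
    Module.Finite A (integralClosure A K) := by
  obtain ⟨d, hd, h⟩ := exists_ne_zero_forall_isIntegral_smul_mem_range (K := K) hdim
  have hdK : algebraMap A K d ≠ 0 := by simpa using hd
  have hle : (integralClosure A K).toSubmodule ≤ Submodule.span A {(algebraMap A K d)⁻¹} := by
    intro b hb
    obtain ⟨a, ha⟩ := h b hb
    refine Submodule.mem_span_singleton.2 ⟨a, ?_⟩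
    rw [Algebra.smul_def, ha, Algebra.smul_def]
    field_simp
  have := isNoetherian_of_le hle
  exact inferInstanceAs (Module.Finite A (integralClosure A K).toSubmodule)

end IntegralClosure

/-! ### Finite extensions of complete local rings. -/

theorem IsPrecomplete.of_finite {R M : Type*} [CommRing R] [AddCommGroup M] [Module R M]
    (I : Ideal R) [IsPrecomplete I R] [Module.Finite R M] : IsPrecomplete I M := by
  rw [← AdicCompletion.of_surjective_iff]
  intro x
  obtain ⟨y, rfl⟩ := AdicCompletion.ofTensorProduct_surjective_of_finite I M x
  induction y with
  | zero => exact ⟨0, by simp⟩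
  | add y z hy hz =>
    obtain ⟨a, ha⟩ := hy
    obtain ⟨b, hb⟩ := hz
    exact ⟨a + b, by rw [map_add, map_add, ha, hb]⟩
  | tmul r m =>
    obtain ⟨r, rfl⟩ := AdicCompletion.of_surjective I R r
    refine ⟨r • m, ?_⟩
    rw [AdicCompletion.ofTensorProduct_tmul]
    ext n
    simp
    rfl

theorem IsAdicComplete.of_finite {R M : Type*} [CommRing R] [IsLocalRing R] [IsNoetherianRing R]
    [AddCommGroup M] [Module R M] [IsAdicComplete (IsLocalRing.maximalIdeal R) R]
    [Module.Finite R M] : IsAdicComplete (IsLocalRing.maximalIdeal R) M :=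
  { IsPrecomplete.of_finite _ with
    haus' := (inferInstance : IsHausdorff (IsLocalRing.maximalIdeal R) M).haus' }

theorem IsAdicComplete.map_algebraMap {R S : Type*} [CommRing R] [CommRing S] [Algebra R S]
    (I : Ideal R) [h : IsAdicComplete I S] : IsAdicComplete (I.map (algebraMap R S)) S :=
  { IsPrecomplete.map_algebraMap_iff.2 h.toIsPrecomplete with
    haus' := (IsHausdorff.map_algebraMap_iff.2 h.toIsHausdorff).haus' }

open IsLocalRing Polynomial in
/-- A domain that is finite over a complete noetherian local ring is local. -/
theorem IsLocalRing.of_finite_of_isAdicComplete (R : Type*) {S : Type*} [CommRing R]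
    [IsLocalRing R] [IsNoetherianRing R] [IsAdicComplete (maximalIdeal R) R] [CommRing S]
    [IsDomain S] [Algebra R S] [Module.Finite R S] [FaithfulSMul R S] : IsLocalRing S := by
  set J : Ideal S := (maximalIdeal R).map (algebraMap R S) with hJ
  have : IsAdicComplete (maximalIdeal R) S := .of_finite
  have : IsAdicComplete J S := .map_algebraMap _
  have : IsArtinianRing (S ⧸ J) := by
    let := Ideal.Quotient.field (maximalIdeal R)
    have : Module.Finite (R ⧸ maximalIdeal R) (S ⧸ J) := .of_restrictScalars_finite R _ _
    exact isArtinian_of_tower (R ⧸ maximalIdeal R) inferInstance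
  -- By Hensel's lemma idempotents lift to roots of `X ^ 2 - X` in the domain `S`, which are only 0
  -- and 1.
  have hidem : ∀ e : S ⧸ J, IsIdempotentElem e → e = 0 ∨ e = 1 := by
    intro e he
    obtain ⟨a, rfl⟩ := Ideal.Quotient.mk_surjective e
    have hf : (X ^ 2 - X : S[X]).Monic := by
      monicity!
    have ha : a ^ 2 - a ∈ J := by
      rw [← Ideal.Quotient.eq_zero_iff_mem, map_sub, map_pow, sub_eq_zero, pow_two]
      exact he
    obtain ⟨b, hb, hab⟩ := HenselianRing.is_henselian (I := J) (X ^ 2 - X) hf a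
      (by simpa using ha) (by
      -- The derivative `2a - 1` is its own inverse modulo `J`: its square is `1 + 4(a² - a)`.
      refine IsUnit.of_mul_eq_one (Ideal.Quotient.mk J (2 * a - 1)) ?_
      simp only [derivative_sub, derivative_X_pow, derivative_X]
      rw [← map_mul, ← map_one (Ideal.Quotient.mk J), Ideal.Quotient.mk_eq_mk_iff_sub_mem]
      convert J.mul_mem_left 4 ha using 1
      simp
      ring)
    have hb' : b * (b - 1) = 0 := by
      simp [IsRoot] at hb
      linear_combination hb
    rw [← Ideal.Quotient.mk_eq_mk_iff_sub_mem] at hab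
    rw [← hab]
    rcases mul_eq_zero.1 hb' with h | h
    · exact .inl (by rw [h, map_zero])
    · exact .inr (by rw [sub_eq_zero.1 h, map_one])
  have hle : ∀ M : Ideal S, M.IsMaximal → J ≤ M := fun M hM => by
    have := Ideal.isMaximal_comap_of_isIntegral_of_isMaximal (R := R) M
    rw [hJ, Ideal.map_le_iff_le_comap, IsLocalRing.eq_maximalIdeal this]
  have hsub : Subsingleton (PrimeSpectrum (S ⧸ J)) := by
    refine ⟨fun x y => ?_⟩
    -- The spectrum of the artinian ring `S ⧸ J` is discrete, so each point is cut out by an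
    -- idempotent.
    obtain ⟨e, he, hx⟩ := PrimeSpectrum.exists_idempotent_basicOpen_eq_of_isClopen
      (isClopen_discrete ({x} : Set (PrimeSpectrum (S ⧸ J))))
    rcases hidem e he with rfl | rfl
    · simp at hx
    · have : y ∈ ({x} : Set _) := by rw [hx]; simp
      exact this.symm
  obtain ⟨M, hM⟩ := Ideal.exists_maximal S
  refine IsLocalRing.of_unique_max_ideal ⟨M, hM, fun M' hM' => ?_⟩
  have hp : ∀ N : Ideal S, N.IsMaximal → ∃ x : PrimeSpectrum (S ⧸ J),
      x.asIdeal.comap (Ideal.Quotient.mk J) = N := fun N hN => by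
    have hk : RingHom.ker (Ideal.Quotient.mk J) ≤ N := by rw [Ideal.mk_ker]; exact hle N hN
    refine ⟨⟨N.map (Ideal.Quotient.mk J),
      Ideal.map_isPrime_of_surjective Ideal.Quotient.mk_surjective hk⟩, ?_⟩
    rw [Ideal.comap_map_of_surjective' _ Ideal.Quotient.mk_surjective]
    exact sup_eq_left.2 hk
  obtain ⟨x, rfl⟩ := hp M hM
  obtain ⟨y, rfl⟩ := hp M' hM'
  rw [Subsingleton.elim x y]

open IsLocalRing in
/-- The integral closure of a complete noetherian local domain of dimension one in its field of
fractions is a discrete valuation ring. -/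
theorem isDiscreteValuationRing_integralClosure_of_isAdicComplete (A K : Type*) [CommRing A]
    [IsDomain A] [Field K] [Algebra A K] [IsFractionRing A K] [IsLocalRing A] [IsNoetherianRing A]
    [IsAdicComplete (maximalIdeal A) A] (hdim : ringKrullDim A = 1) :
    IsDiscreteValuationRing (integralClosure A K) := by
  have := finite_integralClosure_of_isAdicComplete (K := K) hdim
  have : IsLocalRing (integralClosure A K) := .of_finite_of_isAdicComplete A
  have : IsNoetherianRing (integralClosure A K) := IsNoetherianRing.of_finite A _
  have : Ring.DimensionLEOne A := ⟨fun {p} hp _ =>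
    Ring.krullDimLE_one_iff_of_noZeroDivisors.mp (Ring.krullDimLE_iff.mpr (by simp [hdim])) p hp
      ‹_›⟩
  have : IsIntegrallyClosed (integralClosure A K) :=
    integralClosure.isIntegrallyClosedOfFiniteExtension K
  have : IsDedekindDomain (integralClosure A K) := { }
  have hf : ¬ IsField (integralClosure A K) := fun h =>
    (ringKrullDim_eq_one_iff_of_isLocalRing_isDomain.1 hdim).1 (isField_of_isIntegral_of_isField
      (FaithfulSMul.algebraMap_injective A (integralClosure A K)) h)
  exact ((IsDiscreteValuationRing.TFAE _ hf).out 0 2).2 this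

namespace WithZero

theorem le_exp_neg_add_one_iff {x : ℤᵐ⁰} {n : ℤ} : x ≤ exp (-(n + 1)) ↔ x < exp (-n) := by
  induction x using WithZero.expRecOn with
  | zero => simp [-exp_neg]
  | exp a => rw [exp_le_exp, exp_lt_exp]; omega

end WithZero

/-! ### The total ring of fractions as the product of the branch fields. -/

namespace AlgebroidCurve

open scoped nonZeroDivisors WithZero
open IsLocalRing

section Proj

variable {O : Type*} [CommRing O]

@[simp]
theorem proj_algebraMap (p : minimalPrimes O) (a : O) :
    proj p (algebraMap O (FractionRing O) a) =
      algebraMap (O ⧸ p.1) (BranchField p) (Ideal.Quotient.mk p.1 a) := by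
  simp [proj]

theorem mem_nonZeroDivisors_of_forall_notMem [IsReduced O] {a : O}
    (ha : ∀ p : minimalPrimes O, a ∉ p.1) : a ∈ O⁰ := by
  rw [mem_nonZeroDivisors_iff_right]
  intro x hx
  rw [← Ideal.mem_bot, ← nilradical_eq_bot_iff.2 ‹IsReduced O›, nilradical,
    ← Ideal.sInf_minimalPrimes, Ideal.mem_sInf]
  intro p hp
  have : p.IsPrime := hp.1.1
  exact (this.mem_or_mem (hx ▸ p.zero_mem : x * a ∈ p)).resolve_right (ha ⟨p, hp⟩)

theorem eq_zero_of_forall_proj_eq_zero [IsReduced O] {x : FractionRing O}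
    (hx : ∀ p, proj p x = 0) : x = 0 := by
  obtain ⟨a, s, rfl⟩ := IsLocalization.exists_mk'_eq O⁰ x
  rw [IsLocalization.mk'_eq_zero_iff]
  refine ⟨1, ?_⟩
  rw [OneMemClass.coe_one, one_mul, ← Ideal.mem_bot, ← nilradical_eq_bot_iff.2 ‹IsReduced O›,
    nilradical, ← Ideal.sInf_minimalPrimes, Ideal.mem_sInf]
  intro p hp
  have h := congrArg (proj ⟨p, hp⟩) (IsLocalization.mk'_spec (FractionRing O) a s)
  rw [map_mul, hx, zero_mul, proj_algebraMap, eq_comm,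
    FaithfulSMul.algebraMap_eq_zero_iff] at h
  exact Ideal.Quotient.eq_zero_iff_mem.1 h

theorem ext_proj [IsReduced O] {x y : FractionRing O} (h : ∀ p, proj p x = proj p y) : x = y :=
  sub_eq_zero.1 (eq_zero_of_forall_proj_eq_zero fun p => by rw [map_sub, h, sub_self])

theorem mem_nonZeroDivisors_of_forall_proj_ne_zero [IsReduced O] {x : FractionRing O}
    (hx : ∀ p, proj p x ≠ 0) : x ∈ (FractionRing O)⁰ := by
  rw [mem_nonZeroDivisors_iff_right]
  intro y hy
  refine eq_zero_of_forall_proj_eq_zero fun p => ?_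
  have := congrArg (proj p) hy
  rw [map_mul, map_zero] at this
  exact (mul_eq_zero.1 this).resolve_right (hx p)

/-- An element of the ring that lives on the branch `p` only. -/
theorem exists_notMem_forall_mem [IsNoetherianRing O] (p : minimalPrimes O) :
    ∃ e : O, e ∉ p.1 ∧ ∀ q : minimalPrimes O, q ≠ p → e ∈ q.1 := by
  classical
  have := (minimalPrimes.finite_of_isNoetherianRing O).fintype
  have h : ∀ q : minimalPrimes O, ∃ e : O, e ∉ p.1 ∧ (q ≠ p → e ∈ q.1) := by
    intro q
    by_cases hq : q = p
    · exact ⟨1, p.1.ne_top_iff_one.1 p.2.1.1.ne_top, fun h => (h hq).elim⟩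
    · obtain ⟨e, he, he'⟩ := SetLike.not_le_iff_exists.1 fun hle : q.1 ≤ p.1 =>
        hq (Subtype.ext (le_antisymm hle (p.2.2 q.2.1 hle)))
      exact ⟨e, he', fun _ => he⟩
  choose e he he' using h
  refine ⟨∏ q, e q, ?_, fun q hq => Ideal.prod_mem _ (Finset.mem_univ q) (he' q hq)⟩
  rw [Ideal.IsPrime.prod_mem_iff]
  simpa using he

/-- With `y p = a p / b p` and `e q` living on branch `q` only, the fraction `(∑ a q * e q) / (∑ b q
* e q)` keeps just its `p`-terms on branch `p`. -/
theorem exists_forall_proj_eq [IsNoetherianRing O] [IsReduced O] (y : ∀ p, BranchField (O := O) p) :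
    ∃ x, ∀ p, proj p x = y p := by
  classical
  have := (minimalPrimes.finite_of_isNoetherianRing O).fintype
  choose e he he' using exists_notMem_forall_mem (O := O)
  have hsum : ∀ (f : minimalPrimes O → O) (p : minimalPrimes O),
      Ideal.Quotient.mk p.1 (∑ q, f q * e q) = Ideal.Quotient.mk p.1 (f p * e p) := by
    intro f p
    rw [map_sum]
    refine Finset.sum_eq_single p (fun q _ hq => ?_) (by simp)
    exact Ideal.Quotient.eq_zero_iff_mem.2 (Ideal.mul_mem_left _ _ (he' q p hq.symm))
  have hy : ∀ p, ∃ a b : O, b ∉ p.1 ∧ y p * algebraMap (O ⧸ p.1) (BranchField p)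
      (Ideal.Quotient.mk p.1 b) = algebraMap (O ⧸ p.1) (BranchField p) (Ideal.Quotient.mk p.1 a) := by
    intro p
    obtain ⟨a, b, hb, h⟩ := IsFractionRing.div_surjective (A := O ⧸ p.1) (y p)
    obtain ⟨a, rfl⟩ := Ideal.Quotient.mk_surjective a
    obtain ⟨b, rfl⟩ := Ideal.Quotient.mk_surjective b
    have hb0 := nonZeroDivisors.ne_zero hb
    refine ⟨a, b, fun h => hb0 (Ideal.Quotient.eq_zero_iff_mem.2 h), ?_⟩
    rw [← h, div_mul_cancel₀]
    simpa using hb0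
  choose a b hb hy using hy
  have hs : ∑ q, b q * e q ∈ O⁰ := mem_nonZeroDivisors_of_forall_notMem fun p hp => by
    rw [← Ideal.Quotient.eq_zero_iff_mem, hsum, Ideal.Quotient.eq_zero_iff_mem] at hp
    exact (p.2.1.1.mem_or_mem hp).elim (hb p) (he p)
  refine ⟨IsLocalization.mk' _ (∑ q, a q * e q) (⟨_, hs⟩ : O⁰), fun p => ?_⟩
  have h := congrArg (proj p) (IsLocalization.mk'_spec (FractionRing O) (∑ q, a q * e q)
    (⟨_, hs⟩ : O⁰))
  have hne : algebraMap (O ⧸ p.1) (BranchField p) (Ideal.Quotient.mk p.1 (b p * e p)) ≠ 0 := by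
    rw [Ne, FaithfulSMul.algebraMap_eq_zero_iff, Ideal.Quotient.eq_zero_iff_mem]
    exact fun h => (p.2.1.1.mem_or_mem h).elim (hb p) (he p)
  refine mul_right_cancel₀ hne ?_
  rw [map_mul, proj_algebraMap, proj_algebraMap, hsum, hsum] at h
  rw [h]
  simp only [map_mul, ← hy p, mul_assoc]

end Proj

/-! ### Valuations, residue fields and elements of large order. -/

section Curve

variable {k O : Type*} [Field k] [CommRing O] [Algebra k O]

theorem finite_minimalPrimes (hO : IsAlgebroidCurve k O) : Finite (minimalPrimes O) :=
  have : IsNoetherianRing O := hO.toIsNoetherian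
  minimalPrimes.finite_of_isNoetherianRing O

theorem isLocalRing_branch (hO : IsAlgebroidCurve k O) (p : minimalPrimes O) :
    IsLocalRing (O ⧸ p.1) :=
  have := hO.toIsLocalRing
  .of_surjective' _ Ideal.Quotient.mk_surjective

theorem isAdicComplete_branch (hO : IsAlgebroidCurve k O) (p : minimalPrimes O) :
    have := isLocalRing_branch hO p
    IsAdicComplete (maximalIdeal (O ⧸ p.1)) (O ⧸ p.1) := by
  have := hO.toIsLocalRing
  have : IsNoetherianRing O := hO.toIsNoetherian
  have := hO.isAdicComplete
  intro _
  have : IsAdicComplete (maximalIdeal O) (O ⧸ p.1) := .of_finite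
  have h : (maximalIdeal O).map (algebraMap O (O ⧸ p.1)) = maximalIdeal (O ⧸ p.1) := by
    refine IsLocalRing.eq_maximalIdeal ((Ideal.map_eq_top_or_isMaximal_of_surjective _
      Ideal.Quotient.mk_surjective (maximalIdeal.isMaximal O)).resolve_left fun h => ?_)
    rw [← Ideal.comap_eq_top_iff (f := Ideal.Quotient.mk p.1),
      Ideal.comap_map_of_surjective' _ Ideal.Quotient.mk_surjective] at h
    refine (maximalIdeal.isMaximal O).ne_top (top_le_iff.1 (h.ge.trans (sup_le le_rfl ?_)))
    exact le_maximalIdeal (RingHom.ker_ne_top _)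
  rw [← h]
  exact .map_algebraMap _

theorem isDiscreteValuationRing_branchNormalization (hO : IsAlgebroidCurve k O)
    (p : minimalPrimes O) : IsDiscreteValuationRing (BranchNormalization p) := by
  have : IsNoetherianRing O := hO.toIsNoetherian
  have := isLocalRing_branch hO p
  have := isAdicComplete_branch hO p
  exact isDiscreteValuationRing_integralClosure_of_isAdicComplete _ _
    (hO.ringKrullDim_quotient p.1 p.2)

instance isDedekindDomain_branchNormalization (p : minimalPrimes O)
    [IsDiscreteValuationRing (BranchNormalization p)] : IsDedekindDomain (BranchNormalization p) :=
  IsPrincipalIdealRing.isDedekindDomain _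

theorem val_eq (p : minimalPrimes O) [h : IsDiscreteValuationRing (BranchNormalization p)] :
    val p = (IsDiscreteValuationRing.maximalIdeal (BranchNormalization p)).valuation
      (BranchField p) :=
  dif_pos h

theorem val_surjective (hO : IsAlgebroidCurve k O) (p : minimalPrimes O) :
    Function.Surjective (val p) := by
  have := isDiscreteValuationRing_branchNormalization hO p
  rw [val_eq]
  exact IsDedekindDomain.HeightOneSpectrum.valuation_surjective (BranchField p)
    (IsDiscreteValuationRing.maximalIdeal (BranchNormalization p))

theorem isIntegral_of_val_le_one (hO : IsAlgebroidCurve k O) (p : minimalPrimes O)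
    {x : BranchField p} (hx : val p x ≤ 1) : IsIntegral (O ⧸ p.1) x := by
  have := isDiscreteValuationRing_branchNormalization hO p
  rw [val_eq] at hx
  obtain ⟨a, rfl⟩ := IsDiscreteValuationRing.exists_lift_of_le_one (A := BranchNormalization p) hx
  exact a.2

/-- Over an algebraically closed coefficient field, integral extensions of local rings do not enlarge
the residue field. -/
theorem exists_sub_mem_maximalIdeal_of_isIntegral {B : Type*} [CommRing B] [IsLocalRing B]
    [IsLocalRing O] [IsAlgClosed k]
    (hk : Function.Surjective (algebraMap k (ResidueField O))) {f : O →+* B} (hf : f.IsIntegral)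
    (b : B) : ∃ t : k, b - f (algebraMap k O t) ∈ maximalIdeal B := by
  let g : O →+* ResidueField B := (residue B).comp f
  have hcomap : (maximalIdeal B).comap f = maximalIdeal O :=
    eq_maximalIdeal (Ideal.isMaximal_comap_of_isIntegral_of_isMaximal' f hf _)
  have : IsLocalHom g := ⟨fun a ha => by
    by_contra h
    have h' : a ∈ (maximalIdeal B).comap f := hcomap ▸ h
    exact ha.ne_zero ((residue_eq_zero_iff _).2 h')⟩
  have hg : g.IsIntegral := hf.trans _ _ (RingHom.isIntegral_of_surjective _ residue_surjective)
  have hlift : (ResidueField.lift g).IsIntegral := by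
    refine RingHom.IsIntegral.tower_top (residue O) _ ?_
    rwa [ResidueField.lift_comp_residue]
  obtain ⟨t, ht⟩ := (IsAlgClosed.ringHom_bijective_of_isIntegral _
    (RingHom.IsIntegral.trans _ _ (RingHom.isIntegral_of_surjective _ hk) hlift)).2 (residue B b)
  have h : residue B (f (algebraMap k O t)) = residue B b := ht
  exact ⟨t, (residue_eq_zero_iff _).1 (by rw [map_sub, h, sub_self])⟩

/-- The normalized branch is integral over `O` and `k` is algebraically closed, so its residue field
is still `k`. -/
theorem exists_val_sub_lt_one (hO : IsAlgebroidCurve k O) (p : minimalPrimes O)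
    {x : BranchField p} (hx : val p x ≤ 1) :
    ∃ t : k, val p (x - proj p (algebraMap O (FractionRing O) (algebraMap k O t))) < 1 := by
  have := hO.toIsLocalRing
  have := hO.isAlgClosed
  have := isDiscreteValuationRing_branchNormalization hO p
  rw [val_eq] at hx ⊢
  obtain ⟨b, rfl⟩ := IsDiscreteValuationRing.exists_lift_of_le_one (A := BranchNormalization p) hx
  let f : O →+* BranchNormalization p :=
    (algebraMap (O ⧸ p.1) (BranchNormalization p)).comp (Ideal.Quotient.mk p.1)
  have hf : f.IsIntegral := RingHom.IsIntegral.trans _ _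
    (RingHom.isIntegral_of_surjective _ Ideal.Quotient.mk_surjective)
    (algebraMap_isIntegral_iff.2 (integralClosure.AlgebraIsIntegral))
  obtain ⟨t, ht⟩ := exists_sub_mem_maximalIdeal_of_isIntegral hO.bijective_residue.2 hf b
  refine ⟨t, ?_⟩
  have h : proj p (algebraMap O (FractionRing O) (algebraMap k O t)) =
      algebraMap (BranchNormalization p) (BranchField p) (f (algebraMap k O t)) := by
    rw [proj_algebraMap]; rfl
  rw [h, ← map_sub, IsDedekindDomain.HeightOneSpectrum.valuation_lt_one_iff_mem]
  exact ht

/-- The bound is the order of a common denominator `d` of the normalization: beyond it `x / d` is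
integral, so `x = d (x / d)` lies in `O ⧸ p`. -/
theorem exists_val_le_imp_mem_range (hO : IsAlgebroidCurve k O) (p : minimalPrimes O) :
    ∃ n : ℤ, ∀ x : BranchField p, val p x ≤ .exp (-n) →
      ∃ a : O, algebraMap (O ⧸ p.1) (BranchField p) (Ideal.Quotient.mk p.1 a) = x := by
  have : IsNoetherianRing O := hO.toIsNoetherian
  have := isLocalRing_branch hO p
  have := isAdicComplete_branch hO p
  obtain ⟨d, hd, h⟩ := exists_ne_zero_forall_isIntegral_smul_mem_range (K := BranchField p)
    (hO.ringKrullDim_quotient p.1 p.2)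
  have hdK : algebraMap (O ⧸ p.1) (BranchField p) d ≠ 0 := by simpa using hd
  have hval : val p (algebraMap (O ⧸ p.1) (BranchField p) d) ≠ 0 := by simpa using hdK
  refine ⟨-WithZero.log (val p (algebraMap (O ⧸ p.1) (BranchField p) d)), fun x hx => ?_⟩
  rw [neg_neg, WithZero.exp_log hval] at hx
  obtain ⟨a, ha⟩ := h (x / algebraMap (O ⧸ p.1) (BranchField p) d)
    (isIntegral_of_val_le_one hO p (by rw [map_div₀]; exact div_le_one_of_le₀ hx zero_le))
  obtain ⟨a, rfl⟩ := Ideal.Quotient.mk_surjective a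
  exact ⟨a, by rw [ha, Algebra.smul_def, mul_div_cancel₀ _ hdK]⟩

/-- Elements of sufficiently large order lie in the ring. -/
theorem exists_forall_val_le_imp_mem_one (hO : IsAlgebroidCurve k O) :
    ∃ N : minimalPrimes O → ℤ, ∀ h : FractionRing O, (∀ p, val p (proj p h) ≤ .exp (-(N p))) →
      h ∈ (1 : Submodule O (FractionRing O)) := by
  classical
  have : IsNoetherianRing O := hO.toIsNoetherian
  have := hO.toIsReduced
  have := finite_minimalPrimes hO
  have := Fintype.ofFinite (minimalPrimes O)
  choose e he he' using exists_notMem_forall_mem (O := O)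
  choose n hn using exists_val_le_imp_mem_range hO
  let E : ∀ p : minimalPrimes O, BranchField p := fun p =>
    algebraMap (O ⧸ p.1) (BranchField p) (Ideal.Quotient.mk p.1 (e p))
  have hE : ∀ p, E p ≠ 0 := fun p => by
    simpa [E, Ideal.Quotient.eq_zero_iff_mem] using he p
  have hval : ∀ p, val p (E p) ≠ 0 := fun p => by simpa using hE p
  -- This is `n p` plus the order of `e p`, so that `h / e p` comes from `O` on each branch; the
  -- lifts are glued as `∑ a q * e q`.
  refine ⟨fun p => n p - WithZero.log (val p (E p)), fun h hh => ?_⟩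
  have key : ∀ p, ∃ a : O, algebraMap (O ⧸ p.1) (BranchField p) (Ideal.Quotient.mk p.1 a) =
      proj p h / E p := fun p => hn p _ (by
    rw [map_div₀, div_le_iff₀ (zero_lt_iff.2 (hval p))]
    refine (hh p).trans_eq ?_
    rw [neg_sub, sub_eq_neg_add, WithZero.exp_add, WithZero.exp_log (hval p)])
  choose a ha using key
  rw [Submodule.mem_one]
  refine ⟨∑ q, a q * e q, ext_proj fun p => ?_⟩
  rw [proj_algebraMap, map_sum, Finset.sum_eq_single p, map_mul, map_mul, ha]
  · exact div_mul_cancel₀ _ (hE p)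
  · exact fun q _ hq => Ideal.Quotient.eq_zero_iff_mem.2 (Ideal.mul_mem_left _ _ (he' q p hq.symm))
  · simp

end Curve

end AlgebroidCurve

/-! ### Leading coefficients, the semigroup of values and its conductor. -/

namespace AlgebroidCurve

open scoped nonZeroDivisors WithZero

theorem val_proj_smul_le {O : Type*} [CommRing O] (p : minimalPrimes O) (a : O)
    (h : FractionRing O) : val p (proj p (a • h)) ≤ val p (proj p h) := by
  rw [Algebra.smul_def, map_mul, map_mul, proj_algebraMap]
  exact mul_le_of_le_one_left' (val_algebraMap_le_one p _)

section Scalars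

variable {k O : Type*} [Field k] [CommRing O] [Algebra k O]

theorem val_proj_algebraMap_eq_one (p : minimalPrimes O) {t : k} (ht : t ≠ 0) :
    val p (proj p (algebraMap O (FractionRing O) (algebraMap k O t))) = 1 := by
  have hle : ∀ s : k, val p (proj p (algebraMap O (FractionRing O) (algebraMap k O s))) ≤ 1 :=
    fun s => by rw [proj_algebraMap]; exact val_algebraMap_le_one p _
  refine le_antisymm (hle t) ?_
  have h : val p (proj p (algebraMap O (FractionRing O) (algebraMap k O t))) *
      val p (proj p (algebraMap O (FractionRing O) (algebraMap k O t⁻¹))) = 1 := by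
    simp only [← map_mul, mul_inv_cancel₀ ht, map_one]
  rw [← h]
  exact mul_le_of_le_one_right' (hle t⁻¹)

theorem val_proj_smul_eq (p : minimalPrimes O) {t : k} (ht : t ≠ 0) (h : FractionRing O) :
    val p (proj p (algebraMap k O t • h)) = val p (proj p h) := by
  rw [Algebra.smul_def, map_mul, map_mul, val_proj_algebraMap_eq_one p ht, one_mul]

/-- Leading coefficients on a branch can be cancelled with scalars. -/
theorem exists_val_sub_smul_lt (hO : IsAlgebroidCurve k O) (p : minimalPrimes O)
    {g h : FractionRing O} (hg : proj p g ≠ 0) (hgh : val p (proj p h) ≤ val p (proj p g)) :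
    ∃ t : k, val p (proj p (h - algebraMap k O t • g)) < val p (proj p g) := by
  have hv : val p (proj p g) ≠ 0 := by simpa using hg
  obtain ⟨t, ht⟩ := exists_val_sub_lt_one hO p (x := proj p h / proj p g)
    (by rw [map_div₀]; exact div_le_one_of_le₀ hgh zero_le)
  refine ⟨t, ?_⟩
  have : proj p (h - algebraMap k O t • g) = (proj p h / proj p g -
      proj p (algebraMap O (FractionRing O) (algebraMap k O t))) * proj p g := by
    rw [sub_mul, div_mul_cancel₀ _ hg, map_sub, Algebra.smul_def, map_mul]
  rw [this, map_mul]
  exact mul_lt_of_lt_one_left (zero_lt_iff.2 hv) ht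

end Scalars

theorem HasValue.proj_ne_zero {O : Type*} [CommRing O] {h : FractionRing O}
    {α : minimalPrimes O → ℤ} (hα : HasValue h α) (p : minimalPrimes O) : proj p h ≠ 0 := by
  have : val p (proj p h) ≠ 0 := by rw [hα p]; exact WithZero.exp_ne_zero
  simpa using this

theorem mem_semigroup_iff {O : Type*} [CommRing O] [IsReduced O] {α : minimalPrimes O → ℤ} :
    α ∈ semigroup O ↔ ∃ h ∈ (1 : Submodule O (FractionRing O)), HasValue h α :=
  ⟨fun ⟨h, hh, _, hα⟩ => ⟨h, hh, hα⟩, fun ⟨h, hh, hα⟩ =>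
    ⟨h, hh, mem_nonZeroDivisors_of_forall_proj_ne_zero hα.proj_ne_zero, hα⟩⟩

theorem nonneg_of_mem_semigroup {O : Type*} [CommRing O] {α : minimalPrimes O → ℤ}
    (hα : α ∈ semigroup O) : 0 ≤ α := by
  obtain ⟨h, hh, _, hv⟩ := hα
  obtain ⟨a, rfl⟩ := Submodule.mem_one.1 hh
  intro p
  have := val_algebraMap_le_one p (Ideal.Quotient.mk p.1 a)
  rw [← proj_algebraMap, hv p, ← WithZero.exp_zero, WithZero.exp_le_exp] at this
  simpa using this

section Curve

variable {k O : Type*} [Field k] [CommRing O] [Algebra k O]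

theorem exists_hasValue (hO : IsAlgebroidCurve k O) (α : minimalPrimes O → ℤ) :
    ∃ h : FractionRing O, HasValue h α := by
  have : IsNoetherianRing O := hO.toIsNoetherian
  have := hO.toIsReduced
  choose y hy using fun p => val_surjective hO p (.exp (-(α p)))
  obtain ⟨h, hh⟩ := exists_forall_proj_eq y
  exact ⟨h, fun p => by rw [hh, hy]⟩

/-- A general combination `g + t h` has the minimal order on every branch: each of the finitely many
branches excludes at most one scalar, and `k` is infinite. -/
theorem inf_mem_semigroup (hO : IsAlgebroidCurve k O) {α β : minimalPrimes O → ℤ}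
    (hα : α ∈ semigroup O) (hβ : β ∈ semigroup O) : α ⊓ β ∈ semigroup O := by
  have := hO.toIsReduced
  have := hO.isAlgClosed
  have := finite_minimalPrimes hO
  have : Infinite k := IsAlgClosed.instInfinite
  obtain ⟨g, hg, hgα⟩ := mem_semigroup_iff.1 hα
  obtain ⟨h, hh, hhβ⟩ := mem_semigroup_iff.1 hβ
  have hmax : ∀ p, max (val p (proj p g)) (val p (proj p h)) = .exp (-((α ⊓ β) p)) := fun p => by
    rw [hgα p, hhβ p, Pi.inf_apply]
    rcases le_total (α p) (β p) with hle | hle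
    · rw [inf_eq_left.2 hle, max_eq_left (by rw [WithZero.exp_le_exp]; omega)]
    · rw [inf_eq_right.2 hle, max_eq_right (by rw [WithZero.exp_le_exp]; omega)]
  let bad : minimalPrimes O → Set k := fun p =>
    {t | val p (proj p (g + algebraMap k O t • h)) < .exp (-((α ⊓ β) p))}
  have hbad : ∀ p, (bad p).Subsingleton := by
    intro p s hs t ht
    by_contra hst
    simp only [bad, Set.mem_ofPred_eq, ← hmax] at hs ht
    -- Two bad scalars force `h` above the minimal order; then `g` attains it alone and nothing can
    -- cancel.
    have h1 : val p (proj p h) < max (val p (proj p g)) (val p (proj p h)) := by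
      conv_lhs => rw [← val_proj_smul_eq p (sub_ne_zero.2 hst) h]
      have : algebraMap k O (s - t) • h =
          (g + algebraMap k O s • h) - (g + algebraMap k O t • h) := by
        rw [map_sub, sub_smul]; abel
      rw [this, map_sub]
      exact (val p).map_sub_lt hs ht
    have h2 : val p (proj p h) < val p (proj p g) := by simpa using h1
    have h3 : val p (proj p (algebraMap k O s • h)) < val p (proj p g) :=
      (val_proj_smul_le p _ h).trans_lt h2
    rw [max_eq_left h2.le, map_add, Valuation.map_add_eq_of_lt_left _ h3] at hs
    exact lt_irrefl _ hs
  obtain ⟨t, ht⟩ : ∃ t, t ∉ ⋃ p, bad p :=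
    (Set.finite_iUnion fun p => (hbad p).finite).exists_notMem
  refine mem_semigroup_iff.2 ⟨g + algebraMap k O t • h, add_mem hg (Submodule.smul_mem _ _ hh),
    fun p => le_antisymm ?_ (not_lt.1 fun hlt => ht (Set.mem_iUnion.2 ⟨p, hlt⟩))⟩
  rw [map_add, ← hmax]
  exact ((val p).map_add _ _).trans (max_le_max le_rfl (val_proj_smul_le p _ h))

theorem exists_isConductor (hO : IsAlgebroidCurve k O) : ∃ c, IsConductor (semigroup O) c := by
  have := hO.toIsReduced
  have := finite_minimalPrimes hO
  have := Fintype.ofFinite (minimalPrimes O)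
  obtain ⟨N, hN⟩ := exists_forall_val_le_imp_mem_one hO
  have hNS : ∀ β, N ≤ β → β ∈ semigroup O := fun β hβ => by
    obtain ⟨h, hh⟩ := exists_hasValue hO β
    refine mem_semigroup_iff.2 ⟨h, hN h fun p => ?_, hh⟩
    rw [hh p, WithZero.exp_le_exp]
    exact neg_le_neg (hβ p)
  let T : Set (minimalPrimes O → ℤ) := {γ | γ ∈ semigroup O ∧ ∀ β, γ ≤ β → β ∈ semigroup O}
  have hinf : ∀ γ ∈ T, ∀ γ' ∈ T, γ ⊓ γ' ∈ T := by
    intro γ hγ γ' hγ'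
    refine ⟨inf_mem_semigroup hO hγ.1 hγ'.1, fun β hβ => ?_⟩
    have : β = (β ⊔ γ) ⊓ (β ⊔ γ') := by rw [← sup_inf_left, sup_eq_left.2 hβ]
    rw [this]
    exact inf_mem_semigroup hO (hγ.2 _ le_sup_right) (hγ'.2 _ le_sup_right)
  have hne : T.Nonempty := ⟨N, hNS N le_rfl, hNS⟩
  -- Values of `O` are nonnegative, so `toNat` loses nothing; as `T` is closed under minima, a
  -- member of least coordinate sum is its least element.
  let f : (minimalPrimes O → ℤ) → ℕ := fun γ => (∑ p, γ p).toNat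
  refine ⟨Function.argminOn f T hne, Function.argminOn_mem f T hne, fun γ hγ => ?_⟩
  set c := Function.argminOn f T hne with hc
  have hcT : c ∈ T := Function.argminOn_mem f T hne
  have hmin : f c ≤ f (c ⊓ γ) := Function.argminOn_le f T (hinf c hcT γ hγ)
  have hsum : ∑ p, c p ≤ ∑ p, (c ⊓ γ) p := by
    have := Finset.sum_nonneg fun p (_ : p ∈ Finset.univ) =>
      nonneg_of_mem_semigroup (hinf c hcT γ hγ).1 p
    simp only [f] at hmin
    omega
  intro p
  by_contra hlt
  refine hsum.not_gt (Finset.sum_lt_sum (fun q _ => inf_le_left) ⟨p, Finset.mem_univ p, ?_⟩)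
  exact inf_lt_left.2 hlt

/-- This turns a statement about values into one about elements. Subtracting multiples of elements
of `O` with value `β ≥ c` raises the order one branch at a time until it exceeds the bound `N`; the
induction is on the total deficit below `N`. -/
theorem filtration_one_le (hO : IsAlgebroidCurve k O) {c : minimalPrimes O → ℤ}
    (hc : ∀ β, c ≤ β → β ∈ semigroup O) {h : FractionRing O}
    (hh : ∀ p, val p (proj p h) ≤ .exp (-(c p))) : h ∈ (1 : Submodule O (FractionRing O)) := by
  classical
  have := hO.toIsReduced
  have := finite_minimalPrimes hO
  have := Fintype.ofFinite (minimalPrimes O)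
  obtain ⟨N, hN⟩ := exists_forall_val_le_imp_mem_one hO
  suffices H : ∀ (m : ℕ) (β : minimalPrimes O → ℤ), c ≤ β → ∑ p, (N p - β p).toNat = m →
      ∀ h : FractionRing O, (∀ p, val p (proj p h) ≤ .exp (-(β p))) →
        h ∈ (1 : Submodule O (FractionRing O)) from H _ c le_rfl rfl h hh
  intro m
  induction m with
  | zero =>
    intro β _ hsum h hh
    refine hN h fun p => (hh p).trans ?_
    have := (Finset.sum_eq_zero_iff.1 hsum) p (Finset.mem_univ p)
    rw [WithZero.exp_le_exp]
    omega
  | succ m ih =>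
    intro β hβ hsum h hh
    obtain ⟨i, hi⟩ : ∃ i, 0 < (N i - β i).toNat := by
      by_contra! hcon
      rw [Finset.sum_eq_zero fun p _ => Nat.le_zero.1 (hcon p)] at hsum
      omega
    obtain ⟨g, hg, hgβ⟩ := mem_semigroup_iff.1 (hc β hβ)
    obtain ⟨t, ht⟩ := exists_val_sub_smul_lt hO i (hgβ.proj_ne_zero i) ((hh i).trans_eq (hgβ i).symm)
    rw [hgβ i] at ht
    have key : h - algebraMap k O t • g ∈ (1 : Submodule O (FractionRing O)) := by
      refine ih (β + basisVec i) (hβ.trans ?_) ?_ _ fun p => ?_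
      · intro p
        rcases eq_or_ne p i with rfl | hp
        · simp [basisVec]
        · simp [basisVec, hp]
      · rw [← Finset.add_sum_erase _ _ (Finset.mem_univ i)] at hsum ⊢
        rw [Finset.sum_congr rfl (g := fun p => (N p - β p).toNat)]
        · simp only [basisVec, Pi.add_apply, Pi.single_eq_same]
          omega
        · intro p hp
          simp [basisVec, Finset.ne_of_mem_erase hp]
      · rcases eq_or_ne p i with rfl | hp
        · simpa only [basisVec, Pi.add_apply, Pi.single_eq_same,
            WithZero.le_exp_neg_add_one_iff] using ht
        · simp only [basisVec, Pi.add_apply, Pi.single_eq_of_ne hp, add_zero, map_sub]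
          exact (Valuation.map_sub _ _ _).trans (max_le (hh p)
            ((val_proj_smul_le p _ g).trans_eq (hgβ p)))
    simpa using add_mem key (Submodule.smul_mem _ (algebraMap k O t) hg)

/-- An element of the ring cannot have order exactly one less than the conductor on a branch and
at least the conductor on all others. -/
theorem false_of_val_eq_conductor_sub_one (hO : IsAlgebroidCurve k O) {c : minimalPrimes O → ℤ}
    (hc : IsConductor (semigroup O) c) (i : minimalPrimes O) {f : FractionRing O}
    (hf : f ∈ (1 : Submodule O (FractionRing O))) (hfi : val i (proj i f) = .exp (-(c i - 1)))
    (hfp : ∀ p, p ≠ i → val p (proj p f) ≤ .exp (-(c p))) : False := by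
  have := hO.toIsReduced
  -- The only new case is `β i = c i - 1`: an element `x` of the total fraction ring with value `β`
  -- becomes of order at least `c` after subtracting a multiple of `f`, hence lies in `O`.
  have hall : ∀ β, c - basisVec i ≤ β → β ∈ semigroup O := by
    intro β hβ
    by_cases hcβ : c ≤ β
    · exact hc.1.2 β hcβ
    have hβp : ∀ p, p ≠ i → c p ≤ β p := fun p hp => by
      simpa [basisVec, hp] using hβ p
    have hβi : β i = c i - 1 := by
      have h1 : c i - 1 ≤ β i := by simpa [basisVec] using hβ i
      refine le_antisymm ?_ h1
      by_contra hlt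
      refine hcβ fun p => ?_
      rcases eq_or_ne p i with rfl | hp
      · exact not_lt.1 fun h => hlt (Int.le_sub_one_of_lt h)
      · exact hβp p hp
    obtain ⟨x, hx⟩ := exists_hasValue hO β
    have hfi0 : proj i f ≠ 0 := by
      have : val i (proj i f) ≠ 0 := by rw [hfi]; exact WithZero.exp_ne_zero
      simpa using this
    obtain ⟨t, ht⟩ := exists_val_sub_smul_lt hO i (h := x) hfi0 (by rw [hfi, hx i, hβi])
    have key : x - algebraMap k O t • f ∈ (1 : Submodule O (FractionRing O)) := by
      refine filtration_one_le hO hc.1.2 fun p => ?_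
      rcases eq_or_ne p i with rfl | hp
      · rw [hfi, ← WithZero.le_exp_neg_add_one_iff, sub_add_cancel] at ht
        exact ht
      · rw [map_sub]
        refine (Valuation.map_sub _ _ _).trans (max_le ?_
          ((val_proj_smul_le p _ f).trans (hfp p hp)))
        rw [hx p, WithZero.exp_le_exp]
        exact neg_le_neg (hβp p hp)
    refine mem_semigroup_iff.2 ⟨x, ?_, hx⟩
    simpa using add_mem key (Submodule.smul_mem _ (algebraMap k O t) hf)
  have := hc.2 ⟨hall _ le_rfl, hall⟩ i
  simp [basisVec] at this

/-! ### Lengths of the filtration quotients and the inequality. -/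

theorem colength_eq_zero_of_le {M N : Submodule O (FractionRing O)} (h : M ≤ N) :
    colength M N = 0 := by
  rw [colength, Module.length_eq_zero_iff, Submodule.Quotient.subsingleton_iff,
    Submodule.submoduleOf_eq_top]
  exact h

/-- An element of `M(α)` outside `M(α + e_i)` has order exactly `α_i` on the branch `i`. -/
theorem val_eq_of_mem_of_notMem {M : Submodule O (FractionRing O)} {α : minimalPrimes O → ℤ}
    {i : minimalPrimes O} {x : FractionRing O} (hx : x ∈ filtration M α)
    (hx' : x ∉ filtration M (α + basisVec i)) : val i (proj i x) = .exp (-(α i)) := by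
  refine le_antisymm (hx.2 i) (not_lt.1 fun hlt => hx' ⟨hx.1, fun p => ?_⟩)
  rcases eq_or_ne p i with rfl | hp
  · simpa only [basisVec, Pi.add_apply, Pi.single_eq_same, WithZero.le_exp_neg_add_one_iff]
      using hlt
  · simpa only [basisVec, Pi.add_apply, Pi.single_eq_of_ne hp, add_zero] using hx.2 p

/-- Any nonzero class generates the quotient, since its leading coefficient on branch `i` cancels
that of any other element up to a scalar. -/
theorem colength_filtration_le_one (hO : IsAlgebroidCurve k O) (M : Submodule O (FractionRing O))
    (α : minimalPrimes O → ℤ) (i : minimalPrimes O) :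
    colength (filtration M α) (filtration M (α + basisVec i)) ≤ 1 := by
  by_cases hle : filtration M α ≤ filtration M (α + basisVec i)
  · rw [colength_eq_zero_of_le hle]
    exact zero_le_one
  refine le_of_eq (Module.length_eq_one_iff.2 (isSimpleModule_iff_toSpanSingleton_surjective.2
    ⟨Submodule.Quotient.nontrivial_iff.2 fun h => hle (Submodule.submoduleOf_eq_top.1 h), ?_⟩))
  intro v hv w
  obtain ⟨⟨x, hx⟩, rfl⟩ := Submodule.Quotient.mk_surjective _ v
  obtain ⟨⟨y, hy⟩, rfl⟩ := Submodule.Quotient.mk_surjective _ w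
  have hx' : x ∉ filtration M (α + basisVec i) := fun h =>
    hv ((Submodule.Quotient.mk_eq_zero _).2 h)
  have hvx := val_eq_of_mem_of_notMem hx hx'
  have hx0 : proj i x ≠ 0 := by
    have : val i (proj i x) ≠ 0 := by rw [hvx]; exact WithZero.exp_ne_zero
    simpa using this
  obtain ⟨t, ht⟩ := exists_val_sub_smul_lt hO i hx0 ((hy.2 i).trans_eq hvx.symm)
  refine ⟨algebraMap k O t, ?_⟩
  rw [LinearMap.toSpanSingleton_apply, eq_comm, ← Submodule.Quotient.mk_smul,
    Submodule.Quotient.eq]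
  by_contra hcon
  have hmem : y - algebraMap k O t • x ∈ filtration M α :=
    sub_mem hy (Submodule.smul_mem _ _ hx)
  exact ht.ne ((val_eq_of_mem_of_notMem hmem hcon).trans hvx.symm)

end Curve

end AlgebroidCurve

theorem mainTheorem7 {k O : Type*} [Field k] [CommRing O] [Algebra k O]
    (_hO : IsAlgebroidCurve k O) :
    ∃ c : minimalPrimes O → ℤ,
      AlgebroidCurve.IsConductor (AlgebroidCurve.semigroup O) c ∧
      ∀ M : Submodule O (FractionRing O), AlgebroidCurve.IsFractionalIdeal M →
        ∀ (α : minimalPrimes O → ℤ) (i : minimalPrimes O),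
          AlgebroidCurve.colength
              (AlgebroidCurve.filtration M α)
              (AlgebroidCurve.filtration M (α + AlgebroidCurve.basisVec i)) +
            AlgebroidCurve.colength
              (AlgebroidCurve.filtration (AlgebroidCurve.dual M)
                (c - α - AlgebroidCurve.basisVec i))
              (AlgebroidCurve.filtration (AlgebroidCurve.dual M) (c - α)) ≤ 1 := by
  open AlgebroidCurve in
  obtain ⟨c, hc⟩ := exists_isConductor _hO
  refine ⟨c, hc, fun M _ α i => ?_⟩
  -- Gives the dual quotient the same shape `β`, `β + e_i` as the first one.
  have hdual : c - α = (c - α - basisVec i) + basisVec i := (sub_add_cancel _ _).symm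
  by_cases h1 : filtration M α ≤ filtration M (α + basisVec i)
  · rw [colength_eq_zero_of_le h1, zero_add]
    nth_rw 2 [hdual]
    exact colength_filtration_le_one _hO _ _ i
  by_cases h2 : filtration (dual M) (c - α - basisVec i) ≤ filtration (dual M) (c - α)
  · rw [colength_eq_zero_of_le h2, add_zero]
    exact colength_filtration_le_one _hO _ _ i
  exfalso
  obtain ⟨x, hx, hx'⟩ := SetLike.not_le_iff_exists.1 h1
  obtain ⟨y, hy, hy'⟩ := SetLike.not_le_iff_exists.1 h2
  rw [hdual] at hy'
  -- The orders on branch `i` add up to `(c i - α i - 1) + α i = c i - 1`; on the others, to at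
  -- least `c p`.
  refine false_of_val_eq_conductor_sub_one _hO hc i (f := y * x)
    (Submodule.mem_div_iff_forall_mul_mem.1 hy.1 x hx.1) ?_ fun p hp => ?_
  · rw [map_mul, map_mul, val_eq_of_mem_of_notMem hx hx', val_eq_of_mem_of_notMem hy hy',
      ← WithZero.exp_add]
    simp only [basisVec, Pi.sub_apply, Pi.single_eq_same]
    congr 1
    ring
  · rw [map_mul, map_mul]
    refine (mul_le_mul' (hy.2 p) (hx.2 p)).trans_eq ?_
    rw [← WithZero.exp_add]
    simp only [basisVec, Pi.sub_apply, Pi.single_eq_of_ne hp]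
    congr 1
    ring
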